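/- Let $k$ be a field and let $s(n)$ ($n\ge 2$) be positive integers. Let $X,\beta_0,\beta_1$ be indeterminates over $k$ and define, in the field $k(X,\beta_0,\beta_1)$, $$\beta_n=\frac{\beta_{n-2}-\beta_{n-1}^{\,s(n)}}{X}\qquad(n\ge 2).$$ For $n\ge 1$ put $J_n=k[X,\beta_{n-1},\beta_n]$, and let $J$ be the $k$-subalgebra of $k(X,\beta_0,\beta_1)$ generated by all the $J_n$. Call a finite-dimensional integral domain $R$ a Jaffard domain if $\dim R[Y_1,\dots,Y_m]=m+\dim R$ for all $m\ge 1$, and call a finite-dimensional ring catenarian if for all prime ideals $P\subseteq Q$ any two saturated chains of primes from $P$ to $Q$ have the same length. Then: 1. For every $n\ge1$ the elements $X,\beta_{n-1},\beta_n$ are algebraically independent over $k$ (so $J_n$ is a polynomial ring in three indeterminates) and $J_n\subseteq J_{n+1}$; moreover $J=\bigcup_{n\ge 1}J_n$. 2. $\dim J=3$ and $J$ is a Jaffard domain. 3. If $s(n)\ge 2$ for infinitely many $n$, then $J$ is factorial, the ideals $XJ$ and $M=(X,\beta_0,\beta_1,\dots,\beta_n,\dots)$ of $J$ are prime, $(0)\subset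 XJ\subset M$ is a saturated chain of prime ideals, $\operatorname{ht}M=3$, and consequently $J$ is not catenarian. -/

import Mathlib

/-- A saturated chain of prime ideals of `R`: a finite chain in which every step is a covering,
i.e. no prime lies strictly between two consecutive terms. -/
abbrev SaturatedPrimeChain (R : Type*) [CommRing R] : Type _ :=
  RelSeries {pq : PrimeSpectrum R × PrimeSpectrum R | pq.1 ⋖ pq.2}

/-- `R` is catenarian: for all primes `P ⊆ Q`, the chains of primes from `P` to `Q` have bounded
length, and all saturated ones have the same length. -/
def IsCatenarian (R : Type*) [CommRing R] : Prop :=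
  ∀ P Q : PrimeSpectrum R, P ≤ Q → ∃ n : ℕ,
    (∀ c : LTSeries (PrimeSpectrum R), c.head = P → c.last = Q → c.length ≤ n) ∧
    (∀ c : SaturatedPrimeChain R, c.head = P → c.last = Q → c.length = n)

/-- A domain `R` is Jaffard if it is finite-dimensional and
`dim R[X₁, …, Xₙ] = n + dim R` for all `n ≥ 1`. -/
def IsJaffard (R : Type*) [CommRing R] [IsDomain R] : Prop :=
  ringKrullDim R < ⊤ ∧
    ∀ n : ℕ, 1 ≤ n → ringKrullDim (MvPolynomial (Fin n) R) = (n : WithBot ℕ∞) + ringKrullDim R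

namespace David

/-- The field `k(X, β₀, β₁)` of rational functions in three indeterminates. -/
abbrev RatField (k : Type*) [Field k] : Type _ := FractionRing (MvPolynomial (Fin 3) k)

/-- The indeterminate `X`. -/
noncomputable def x (k : Type*) [Field k] : RatField k :=
  algebraMap (MvPolynomial (Fin 3) k) (RatField k) (MvPolynomial.X 0)

/-- `β₀` and `β₁` are the other two indeterminates, and
`βₙ = (βₙ₋₂ - βₙ₋₁ ^ s(n)) / X` for `n ≥ 2`. -/
noncomputable def beta (k : Type*) [Field k] (s : ℕ → ℕ) : ℕ → RatField k
  | 0 => algebraMap (MvPolynomial (Fin 3) k) (RatField k) (MvPolynomial.X 1)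
  | 1 => algebraMap (MvPolynomial (Fin 3) k) (RatField k) (MvPolynomial.X 2)
  | n + 2 => (beta k s n - beta k s (n + 1) ^ s (n + 2)) / x k

/-- `Jₙ = k[X, βₙ₋₁, βₙ]`, used for `n ≥ 1` only. -/
noncomputable def stage (k : Type*) [Field k] (s : ℕ → ℕ) (n : ℕ) : Subalgebra k (RatField k) :=
  Algebra.adjoin k {x k, beta k s (n - 1), beta k s n}

/-- `J`, the subalgebra generated by the `Jₙ`, `n ≥ 1` (it is their union, as they ascend). -/
noncomputable def ring (k : Type*) [Field k] (s : ℕ → ℕ) : Subalgebra k (RatField k) :=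
  ⨆ n : ℕ, stage k s (n + 1)

theorem x_mem (k : Type*) [Field k] (s : ℕ → ℕ) : x k ∈ ring k s :=
  (le_iSup (fun n : ℕ => stage k s (n + 1)) 0) (Algebra.subset_adjoin (by simp))

theorem beta_mem (k : Type*) [Field k] (s : ℕ → ℕ) (n : ℕ) : beta k s n ∈ ring k s :=
  (le_iSup (fun n : ℕ => stage k s (n + 1)) n) (Algebra.subset_adjoin (by simp))

/-- The ideal `XJ` of `J`. -/
noncomputable def idealX (k : Type*) [Field k] (s : ℕ → ℕ) : Ideal (ring k s) :=
  Ideal.span {⟨x k, x_mem k s⟩}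

/-- The ideal `M = (X, β₀, β₁, …, βₙ, …)` of `J`. -/
noncomputable def idealM (k : Type*) [Field k] (s : ℕ → ℕ) : Ideal (ring k s) :=
  Ideal.span (insert ⟨x k, x_mem k s⟩ (Set.range fun n : ℕ => ⟨beta k s n, beta_mem k s n⟩))

end David

/-! Since βₙ = X βₙ₊₂ + βₙ₊₁^s(n+2), the inclusion Jₙ ⊆ Jₙ₊₁ is a polynomial substitution that
becomes invertible once X is inverted. So J is an increasing union of polynomial rings with J[1/X] =
k[X, β₀, β₁][1/X], and any solution of the recursion in a k-algebra defines a homomorphism out of J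
(`exists_algHom`).

Dimension: the strict steps of a chain of primes are witnessed by finitely many elements, all in one
stage, so dim J[Y₁, …, Yₘ] ≤ 3 + m. Two homomorphisms killing some or all of the βₙ provide primes
between 0 and M, forming a chain of length 3 (`exists_chain`).

Part 3 rests on the fact that no nonzero element of J is divisible by all powers of X. In passing to
the next stage, the degree in the last variable of the reduction mod X is divided by at least s(n+2)
(`exists_nestedShift_eq`); once it is 0, no further factor X can appear. Hence every nonzero f is
Xⁿg with X ∤ g, which gives height one for XJ and lets primes of k[X, β₀, β₁] be corrected to primes
of J. Modulo X every element is a polynomial in a single βₙ, so no prime lies strictly between XJ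
and M. The saturated chain of length 2 then contradicts the chain of length 3. -/

theorem ringKrullDim_le_of_finset_subset_range {R : Type*} [CommRing R] {d : ℕ}
    {A : Type*} [CommRing A] (hA : ringKrullDim A ≤ d)
    (h : ∀ S : Finset R, ∃ f : A →+* R, (S : Set R) ⊆ Set.range f) :
    ringKrullDim R ≤ d := by
  classical
  refine iSup_le fun p => ?_
  -- One witness per strict inclusion: if all of them lie in the image of `f`, the contracted chain
  -- stays strict.
  have hlt : ∀ i : Fin p.length, ∃ a : R,
      a ∈ (p i.succ).asIdeal ∧ a ∉ (p i.castSucc).asIdeal := fun i =>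
    SetLike.exists_of_lt (p.step i)
  choose a ha ha' using hlt
  obtain ⟨f, hf⟩ := h (Finset.univ.image a)
  let q : LTSeries (PrimeSpectrum A) :=
    { length := p.length
      toFun := fun i => PrimeSpectrum.comap f (p i)
      step := fun i => by
        obtain ⟨b, hb⟩ := hf (a := a i) (by simp)
        refine lt_of_le_of_ne (Ideal.comap_mono (p.step i).le :
          PrimeSpectrum.comap f (p i.castSucc) ≤ PrimeSpectrum.comap f (p i.succ))
          fun heq => ha' i ?_
        have hmem : b ∈ (PrimeSpectrum.comap f (p i.succ)).asIdeal := by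
          simpa [hb] using ha i
        have hmem' : b ∈ (PrimeSpectrum.comap f (p i.castSucc)).asIdeal := 
          (SetLike.ext_iff.mp heq b).mpr hmem
        simpa [hb] using hmem' }
  exact (le_iSup (fun p : LTSeries (PrimeSpectrum A) => (p.length : WithBot ℕ∞)) q).trans hA

namespace David

/-! ### The polynomial rings Jₙ and their inclusions -/

section Stage

open MvPolynomial

variable (k : Type*) [Field k] (s : ℕ → ℕ)

theorem x_ne_zero : x k ≠ 0 := by
  simp [x]

theorem beta_eq (n : ℕ) :
    beta k s n = x k * beta k s (n + 2) + beta k s (n + 1) ^ s (n + 2) := by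
  rw [beta, mul_div_cancel₀ _ (x_ne_zero k)]
  ring

/-- The evaluation `k[X, Y, Z] → k(X, β₀, β₁)` at `X, βₙ, βₙ₊₁`. -/
noncomputable def stageHom (n : ℕ) : MvPolynomial (Fin 3) k →ₐ[k] RatField k :=
  aeval ![x k, beta k s n, beta k s (n + 1)]

/-- The inclusion of `k[X, βₙ, βₙ₊₁]` into `k[X, βₙ₊₁, βₙ₊₂]` as a substitution of polynomials. -/
noncomputable def shift (n : ℕ) : MvPolynomial (Fin 3) k →ₐ[k] MvPolynomial (Fin 3) k :=
  aeval ![X 0, X 0 * X 2 + X 1 ^ s (n + 2), X 1]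

theorem stageHom_comp_shift (n : ℕ) :
    (stageHom k s (n + 1)).comp (shift k s n) = stageHom k s n := by
  ext i
  fin_cases i <;> simp [stageHom, shift, ← beta_eq k s n]

theorem stageHom_shift (n : ℕ) (F : MvPolynomial (Fin 3) k) :
    stageHom k s (n + 1) (shift k s n F) = stageHom k s n F :=
  DFunLike.congr_fun (stageHom_comp_shift k s n) F

/-- The only variable outside the image of the substitution is Z, and XZ is the image of Y -
Z^s(n+2); the power of X clears these denominators. -/
theorem exists_shift_eq_pow_mul (n : ℕ) (F : MvPolynomial (Fin 3) k) :
    ∃ (m : ℕ) (G : MvPolynomial (Fin 3) k), shift k s n G = X 0 ^ m * F := by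
  induction F using MvPolynomial.induction_on with
  | C a => exact ⟨0, C a, by simp [shift, algebraMap_eq]⟩
  | add F F' hF hF' =>
    obtain ⟨m, G, hG⟩ := hF
    obtain ⟨m', G', hG'⟩ := hF'
    refine ⟨m + m', X 0 ^ m' * G + X 0 ^ m * G', ?_⟩
    have h0 : shift k s n (X 0) = X 0 := by simp [shift]
    simp only [map_add, map_mul, map_pow, h0, hG, hG']
    ring
  | mul_X F i hF =>
    obtain ⟨m, G, hG⟩ := hF
    fin_cases i
    · refine ⟨m, G * X 0, ?_⟩
      rw [map_mul, hG]
      simp [shift, mul_assoc]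
    · refine ⟨m, G * X 2, ?_⟩
      rw [map_mul, hG]
      simp [shift, mul_assoc]
    · refine ⟨m + 1, G * (X 1 - X 2 ^ s (n + 2)), ?_⟩
      rw [map_mul, hG]
      simp [shift]
      ring

theorem stageHom_injective (n : ℕ) : Function.Injective (stageHom k s n) := by
  induction n with
  | zero =>
    have h : stageHom k s 0 = Algebra.algHom k (MvPolynomial (Fin 3) k) (RatField k) := by
      ext i
      fin_cases i <;> simp [stageHom, x, beta] <;> rfl
    rw [h]
    exact IsFractionRing.injective (MvPolynomial (Fin 3) k) (RatField k)
  | succ n ih =>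
    rw [injective_iff_map_eq_zero]
    intro F hF
    obtain ⟨m, G, hG⟩ := exists_shift_eq_pow_mul k s n F
    have hG0 : G = 0 := by
      apply ih
      rw [← stageHom_shift, hG, map_mul, hF, mul_zero, map_zero]
    rw [hG0, map_zero] at hG
    have hX : (X 0 : MvPolynomial (Fin 3) k) ≠ 0 := X_ne_zero 0
    simpa [hX] using hG.symm

theorem range_stageHom (n : ℕ) : (stageHom k s n).range = stage k s (n + 1) := by
  rw [stageHom, ← Algebra.adjoin_range_eq_range_aeval, stage]
  congr 1
  ext a
  simp
  tauto

theorem stage_le_succ (n : ℕ) : stage k s (n + 1) ≤ stage k s (n + 2) := by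
  rw [← range_stageHom, ← range_stageHom]
  rintro _ ⟨F, rfl⟩
  exact ⟨shift k s n F, stageHom_shift k s n F⟩

theorem monotone_stage : Monotone fun n => stage k s (n + 1) :=
  monotone_nat_of_le_succ (stage_le_succ k s)

theorem coe_ring : (ring k s : Set (RatField k)) = ⋃ n, (stage k s (n + 1) : Set (RatField k)) :=
  Subalgebra.coe_iSup_of_directed (monotone_stage k s).directed_le

end Stage

/-! ### The union J and homomorphisms out of it -/

section Ring

open MvPolynomial

variable {k : Type*} [Field k] {s : ℕ → ℕ}

variable (k s) in
/-- `X` as an element of `J`. -/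
noncomputable def xJ : ring k s := ⟨x k, x_mem k s⟩

variable (k s) in
/-- `βₙ` as an element of `J`. -/
noncomputable def betaJ (n : ℕ) : ring k s := ⟨beta k s n, beta_mem k s n⟩

theorem betaJ_eq (n : ℕ) :
    betaJ k s n = xJ k s * betaJ k s (n + 2) + betaJ k s (n + 1) ^ s (n + 2) :=
  Subtype.ext (beta_eq k s n)

variable (k s) in
/-- The evaluation `k[X, Y, Z] → J` at `X, βₙ, βₙ₊₁`. -/
noncomputable def evalJ (n : ℕ) : MvPolynomial (Fin 3) k →ₐ[k] ring k s :=
  aeval ![xJ k s, betaJ k s n, betaJ k s (n + 1)]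

theorem coe_evalJ (n : ℕ) (F : MvPolynomial (Fin 3) k) :
    (evalJ k s n F : RatField k) = stageHom k s n F := by
  have h : (ring k s).val.comp (evalJ k s n) = stageHom k s n := by
    ext i
    fin_cases i <;> simp [evalJ, stageHom, xJ, betaJ]
  exact DFunLike.congr_fun h F

theorem evalJ_injective (n : ℕ) : Function.Injective (evalJ k s n) := fun F G h =>
  stageHom_injective k s n (by rw [← coe_evalJ, ← coe_evalJ, h])

theorem evalJ_shift (n : ℕ) (F : MvPolynomial (Fin 3) k) :
    evalJ k s (n + 1) (shift k s n F) = evalJ k s n F :=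
  Subtype.ext (by rw [coe_evalJ, coe_evalJ, stageHom_shift])

theorem exists_evalJ_eq_of_le {m n : ℕ} (h : m ≤ n) (F : MvPolynomial (Fin 3) k) :
    ∃ G, evalJ k s n G = evalJ k s m F := by
  induction n, h using Nat.le_induction with
  | base => exact ⟨F, rfl⟩
  | succ n _ ih =>
    obtain ⟨G, hG⟩ := ih
    exact ⟨shift k s n G, by rw [evalJ_shift, hG]⟩

theorem exists_forall_evalJ_eq (f : ring k s) : ∃ n, ∀ N, n ≤ N → ∃ F, evalJ k s N F = f := by
  obtain ⟨f, hf⟩ := f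
  have hf' : f ∈ (ring k s : Set (RatField k)) := hf
  rw [coe_ring, Set.mem_iUnion] at hf'
  obtain ⟨n, hn⟩ := hf'
  rw [← range_stageHom] at hn
  obtain ⟨F, hF⟩ := hn
  refine ⟨n, fun N hN => ?_⟩
  obtain ⟨G, hG⟩ := exists_evalJ_eq_of_le (s := s) hN F
  exact ⟨G, hG.trans (Subtype.ext ((coe_evalJ n F).trans hF))⟩

theorem exists_forall_evalJ_eq_of_finset (S : Finset (ring k s)) :
    ∃ n, ∀ f ∈ S, ∃ F, evalJ k s n F = f := by
  choose n hn using exists_forall_evalJ_eq (k := k) (s := s)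
  exact ⟨S.sup n, fun f hf => hn f _ (Finset.le_sup hf)⟩

/-- A homomorphism out of `J` is determined by a solution of the recursion. -/
theorem exists_algHom {B : Type*} [CommRing B] [Algebra k B] (t : B) (y : ℕ → B)
    (hy : ∀ n, y n = t * y (n + 2) + y (n + 1) ^ s (n + 2)) :
    ∃ π : ring k s →ₐ[k] B, π (xJ k s) = t ∧ (∀ n, π (betaJ k s n) = y n) ∧
      ∀ n F, π (evalJ k s n F) = aeval ![t, y n, y (n + 1)] F := by
  let K : ℕ → Subalgebra k (ring k s) := fun n => (evalJ k s n).range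
  let e : ∀ n, MvPolynomial (Fin 3) k ≃ₐ[k] K n := fun n =>
    AlgEquiv.ofInjective (evalJ k s n) (evalJ_injective n)
  let f : ∀ n, K n →ₐ[k] B := fun n => (aeval ![t, y n, y (n + 1)]).comp (e n).symm.toAlgHom
  have hfe : ∀ n F (h : evalJ k s n F ∈ K n), f n ⟨evalJ k s n F, h⟩ =
      aeval ![t, y n, y (n + 1)] F := by
    intro n F h
    have : (⟨evalJ k s n F, h⟩ : K n) = e n F := Subtype.ext rfl
    simp [f, this]
  have hmono : Monotone K := monotone_nat_of_le_succ fun n => by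
    rintro _ ⟨F, rfl⟩
    exact ⟨shift k s n F, evalJ_shift n F⟩
  have hstep : ∀ n F, aeval ![t, y (n + 1), y (n + 2)] (shift k s n F) =
      aeval ![t, y n, y (n + 1)] F := by
    intro n F
    have h : (aeval ![t, y (n + 1), y (n + 2)]).comp (shift k s n) =
        aeval ![t, y n, y (n + 1)] := by
      ext i
      fin_cases i <;> simp [shift, ← hy n]
    exact DFunLike.congr_fun h F
  have hev : ∀ m n, m ≤ n → ∀ F G, evalJ k s m F = evalJ k s n G →
      aeval ![t, y m, y (m + 1)] F = aeval ![t, y n, y (n + 1)] G := by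
    intro m n h
    induction n, h using Nat.le_induction with
    | base => exact fun F G h => by rw [evalJ_injective m h]
    | succ n hmn ih =>
      intro F G h
      obtain ⟨F', hF'⟩ := exists_evalJ_eq_of_le (s := s) hmn F
      have hG : G = shift k s n F' := by
        apply evalJ_injective (s := s) (n + 1)
        rw [← h, ← hF', evalJ_shift]
      rw [hG, hstep, ih F F' hF'.symm]
  have hle : ∀ i j (h : K i ≤ K j), f i = (f j).comp (Subalgebra.inclusion h) := by
    intro i j h
    ext ⟨_, ⟨F, rfl⟩⟩
    obtain ⟨G, hG⟩ := h ⟨F, rfl⟩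
    have h2 : (Subalgebra.inclusion h ⟨evalJ k s i F, ⟨F, rfl⟩⟩ : K j) =
        ⟨evalJ k s j G, ⟨G, rfl⟩⟩ := Subtype.ext hG.symm
    refine (hfe i F ⟨F, rfl⟩).trans (Eq.trans ?_ (congrArg (f j) h2).symm)
    refine Eq.trans ?_ (hfe j G ⟨G, rfl⟩).symm
    -- The inclusion `K i ≤ K j` does not by itself order the indices, so both cases arise.
    rcases le_total i j with hij | hij
    · exact hev i j hij F G hG.symm
    · exact (hev j i hij G F hG).symm
  have htop : (⊤ : Subalgebra k (ring k s)) ≤ iSup K := by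
    intro g _
    obtain ⟨n, hn⟩ := exists_forall_evalJ_eq g
    obtain ⟨F, hF⟩ := hn n le_rfl
    exact (le_iSup K n) ⟨F, hF⟩
  let π : ring k s →ₐ[k] B :=
    (Subalgebra.iSupLift K hmono.directed_le f hle ⊤ htop).comp
      (Subalgebra.topEquiv (R := k) (A := ring k s)).symm.toAlgHom
  have hπ : ∀ n F, π (evalJ k s n F) = aeval ![t, y n, y (n + 1)] F := by
    intro n F
    rw [← hfe n F ⟨F, rfl⟩]
    exact Subalgebra.iSupLift_of_mem K (dir := hmono.directed_le) (f := f) (hf := hle)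
      (hT := htop) (i := n) (⟨evalJ k s n F, trivial⟩ : (⊤ : Subalgebra k (ring k s))) ⟨F, rfl⟩
  refine ⟨π, ?_, fun n => ?_, hπ⟩
  · simpa [evalJ] using hπ 0 (X 0)
  · simpa [evalJ] using hπ n (X 1)

end Ring

/-! ### Upper bound for the dimension, primality of X, and a chain of length 3 -/

section Ideals

open MvPolynomial

variable {k : Type*} [Field k] {s : ℕ → ℕ}

theorem xJ_ne_zero : xJ k s ≠ 0 := fun h => x_ne_zero k (congrArg Subtype.val h)

theorem evalJ_X_zero (n : ℕ) : evalJ k s n (X 0) = xJ k s := by simp [evalJ]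

theorem evalJ_X_one (n : ℕ) : evalJ k s n (X 1) = betaJ k s n := by simp [evalJ]

theorem evalJ_X_two (n : ℕ) : evalJ k s n (X 2) = betaJ k s (n + 1) := by simp [evalJ]

theorem ringKrullDim_mvPolynomial_ring_le (m : ℕ) :
    ringKrullDim (MvPolynomial (Fin m) (ring k s)) ≤ ((3 + m : ℕ) : WithBot ℕ∞) := by
  classical
  refine ringKrullDim_le_of_finset_subset_range (d := 3 + m)
    (R := MvPolynomial (Fin m) (ring k s))
    (A := MvPolynomial (Fin m) (MvPolynomial (Fin 3) k)) ?_ fun S => ?_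
  · rw [MvPolynomial.ringKrullDim_of_isNoetherianRing,
      MvPolynomial.ringKrullDim_of_isNoetherianRing, ringKrullDim_eq_zero_of_field]
    simp
  · obtain ⟨n, hn⟩ := exists_forall_evalJ_eq_of_finset (k := k) (s := s)
      (S.biUnion fun p => p.support.image fun d => p.coeff d)
    refine ⟨MvPolynomial.map (evalJ k s n : MvPolynomial (Fin 3) k →+* ring k s), fun p hp => ?_⟩
    rw [MvPolynomial.mem_range_map_iff_coeffs_subset]
    intro c hc
    obtain ⟨d, hd, rfl⟩ := MvPolynomial.mem_coeffs_iff.mp hc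
    exact hn _ (Finset.mem_biUnion.mpr ⟨p, hp, Finset.mem_image.mpr ⟨d, hd, rfl⟩⟩)

theorem ringKrullDim_ring_le : ringKrullDim (ring k s) ≤ 3 := by
  have h := ringKrullDim_mvPolynomial_ring_le (k := k) (s := s) 0
  rwa [ringKrullDim_mvPolynomial_of_isEmpty] at h

/-- This is J[1/X] = k[X, β₀, β₁][1/X], with denominators cleared one stage at a time. -/
theorem exists_pow_mul_eq_evalJ_zero (f : ring k s) :
    ∃ N F, xJ k s ^ N * f = evalJ k s 0 F := by
  obtain ⟨n, hn⟩ := exists_forall_evalJ_eq f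
  obtain ⟨F, rfl⟩ := hn n le_rfl
  clear hn
  induction n generalizing F with
  | zero => exact ⟨0, F, by simp⟩
  | succ n ih =>
    obtain ⟨m, G, hG⟩ := exists_shift_eq_pow_mul k s n F
    obtain ⟨N, F', hF'⟩ := ih G
    refine ⟨N + m, F', ?_⟩
    rw [← hF', ← evalJ_shift n, hG, map_mul, map_pow, evalJ_X_zero, pow_add, mul_assoc]

theorem prime_X_zero : Prime (X 0 : MvPolynomial (Fin 3) k) :=
  MvPolynomial.X_prime

/-- X is prime in each stage, and a relation fg = Xh involves only three elements, hence lives in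
one stage. -/
theorem prime_xJ : Prime (xJ k s) := by
  classical
  refine ⟨xJ_ne_zero, fun hu => ?_, fun f g ⟨h, hfg⟩ => ?_⟩
  · obtain ⟨g, hg⟩ := hu.exists_right_inv
    obtain ⟨n, hn⟩ := exists_forall_evalJ_eq g
    obtain ⟨G, rfl⟩ := hn n le_rfl
    refine prime_X_zero.not_isUnit (IsUnit.of_mul_eq_one G (evalJ_injective (s := s) n ?_) :
      IsUnit (X 0 : MvPolynomial (Fin 3) k))
    rw [map_mul, evalJ_X_zero, hg, map_one]
  · obtain ⟨n, hn⟩ := exists_forall_evalJ_eq_of_finset {f, g, h}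
    obtain ⟨F, rfl⟩ := hn f (by simp)
    obtain ⟨G, rfl⟩ := hn g (by simp)
    obtain ⟨H, rfl⟩ := hn h (by simp)
    rw [← evalJ_X_zero n, ← map_mul, ← map_mul] at hfg
    have hdvd : (X 0 : MvPolynomial (Fin 3) k) ∣ F * G := ⟨H, evalJ_injective n hfg⟩
    rw [← evalJ_X_zero n]
    exact (prime_X_zero.dvd_or_dvd hdvd).imp (map_dvd (evalJ k s n)) (map_dvd (evalJ k s n))

theorem idealX_isPrime : (idealX k s).IsPrime :=
  (Ideal.span_singleton_prime xJ_ne_zero).mpr prime_xJ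

theorem mem_idealX {f : ring k s} : f ∈ idealX k s ↔ xJ k s ∣ f := Ideal.mem_span_singleton

theorem xJ_mem_idealM : xJ k s ∈ idealM k s := Ideal.subset_span (Set.mem_insert _ _)

theorem betaJ_mem_idealM (n : ℕ) : betaJ k s n ∈ idealM k s :=
  Ideal.subset_span (Set.mem_insert_of_mem _ ⟨n, rfl⟩)

theorem idealM_le {I : Ideal (ring k s)} (hx : xJ k s ∈ I) (hb : ∀ n, betaJ k s n ∈ I) :
    idealM k s ≤ I := by
  refine Ideal.span_le.mpr (Set.insert_subset hx ?_)
  rintro _ ⟨n, rfl⟩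
  exact hb n

theorem idealX_le_idealM : idealX k s ≤ idealM k s :=
  (Ideal.span_singleton_le_iff_mem _).mpr xJ_mem_idealM

theorem evalJ_sub_constantCoeff_mem (n : ℕ) (F : MvPolynomial (Fin 3) k) :
    evalJ k s n F - algebraMap k (ring k s) (constantCoeff F) ∈ idealM k s := by
  induction F using MvPolynomial.induction_on with
  | C a => simp [evalJ]
  | add F G hF hG =>
    convert! add_mem hF hG using 1
    simp only [map_add]
    ring
  | mul_X F i hF =>
    rw [map_mul, map_mul, constantCoeff_X, mul_zero, map_zero, sub_zero]
    refine Ideal.mul_mem_left _ _ ?_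
    fin_cases i
    · simpa [evalJ] using xJ_mem_idealM (k := k) (s := s)
    · simpa [evalJ] using betaJ_mem_idealM (k := k) (s := s) n
    · simpa [evalJ] using betaJ_mem_idealM (k := k) (s := s) (n + 1)

variable (k s) in
-- Q is the kernel of J → k[X] killing every βₙ, and P the kernel of J → k(X, β₀) killing β₁. The
-- latter target is a field because solving the recursion forwards divides by X. Positivity of the
-- exponents makes the zero sequence a solution.
theorem exists_chain (hs : ∀ n : ℕ, 2 ≤ n → 1 ≤ s n) :
    (idealM k s).IsPrime ∧ ∃ P Q : Ideal (ring k s), P.IsPrime ∧ Q.IsPrime ∧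
      ⊥ < P ∧ P < Q ∧ Q < idealM k s := by
  have hs0 : ∀ n, s (n + 2) ≠ 0 := fun n => by have := hs (n + 2) (by omega); omega
  obtain ⟨π₂, hx₂, hb₂, he₂⟩ := exists_algHom (k := k) (s := s)
    (Polynomial.X : Polynomial k)
    (fun _ => 0) (fun n => by simp [hs0])
  let A := MvPolynomial (Fin 2) k
  let T := FractionRing A
  let t : T := algebraMap A T (X 0)
  have hX : ∀ i : Fin 2, algebraMap A T (X i) ≠ 0 := fun i =>
    (map_ne_zero_iff _ (IsFractionRing.injective A T)).mpr (X_ne_zero i)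
  have ht : t ≠ 0 := hX 0
  -- The recursion has order two, so it is run on pairs (yₙ, yₙ₊₁) starting from (β₀, 0).
  let y : ℕ → T := fun n => Nat.rec (motive := fun _ => T × T)
    (algebraMap A T (X 1), 0) (fun n p => (p.2, (p.1 - p.2 ^ s (n + 2)) / t)) n |>.1
  have hy : ∀ n, y n = t * y (n + 2) + y (n + 1) ^ s (n + 2) := fun n => by
    simp only [y]
    rw [mul_div_cancel₀ _ ht]
    ring
  obtain ⟨π₁, hx₁, hb₁, he₁⟩ := exists_algHom (k := k) (s := s) t y hy
  have hy0 : y 0 = algebraMap A T (X 1) := rfl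
  have hy1 : y 1 = 0 := rfl
  have hM : idealM k s = RingHom.ker ((Polynomial.aeval (0 : k)).comp π₂) := by
    refine le_antisymm (idealM_le ?_ fun n => ?_) fun f hf => ?_
    · simp [RingHom.mem_ker, hx₂]
    · simp [RingHom.mem_ker, hb₂]
    · obtain ⟨n, hn⟩ := exists_forall_evalJ_eq f
      obtain ⟨F, rfl⟩ := hn n le_rfl
      have h1 := evalJ_sub_constantCoeff_mem (s := s) n F
      have h2 : Polynomial.aeval (0 : k) (π₂ (evalJ k s n F)) = 0 := hf
      have h3 : ((Polynomial.aeval (0 : k)).comp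
          (aeval ![(Polynomial.X : Polynomial k), 0, 0])) F = constantCoeff F := by
        have h4 : (Polynomial.aeval (0 : k)).comp
            (aeval ![(Polynomial.X : Polynomial k), 0, 0]) = aeval (0 : Fin 3 → k) := by
          ext i
          fin_cases i <;> simp
        rw [h4, aeval_zero, Algebra.algebraMap_self_apply]
      rw [he₂, ← AlgHom.comp_apply, h3] at h2
      rwa [h2, map_zero, sub_zero] at h1
  have hQM : RingHom.ker π₂ < idealM k s := by
    rw [hM]
    refine lt_of_le_of_ne (fun f hf => ?_) fun h => ?_
    · rw [RingHom.mem_ker] at hf ⊢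
      rw [AlgHom.comp_apply, hf, map_zero]
    · have : xJ k s ∈ RingHom.ker π₂ := by
        rw [h]
        simp [RingHom.mem_ker, hx₂]
      simp [RingHom.mem_ker, hx₂] at this
  have hPQ : RingHom.ker π₁ < RingHom.ker π₂ := by
    refine lt_of_le_of_ne (fun f hf => ?_) fun h => ?_
    · rw [RingHom.mem_ker] at hf ⊢
      -- After multiplication by a power of X, f becomes F(X, β₀, β₁). Then F(X, β₀, 0) = 0 forces
      -- F(X, 0, 0) = 0, and the power of X cancels in k[X].
      obtain ⟨N, F, hF⟩ := exists_pow_mul_eq_evalJ_zero f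
      have h1 := congrArg π₁ hF
      have h2 := congrArg π₂ hF
      rw [map_mul, hf, mul_zero, he₁, zero_add, hy0, hy1] at h1
      rw [map_mul, map_pow, hx₂, he₂] at h2
      have h3 : (aeval ![t, algebraMap A T (X 1), 0] : MvPolynomial (Fin 3) k →ₐ[k] T) =
          (IsScalarTower.toAlgHom k A T).comp (aeval ![X 0, X 1, 0]) := by
        ext i
        fin_cases i <;> simp [t]
      have h4 : (aeval ![Polynomial.X, 0, 0] : MvPolynomial (Fin 3) k →ₐ[k] Polynomial k) =
          (aeval ![Polynomial.X, 0] : A →ₐ[k] _).comp (aeval ![X 0, X 1, 0]) := by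
        ext i
        fin_cases i <;> simp
      rw [h3, AlgHom.comp_apply] at h1
      have h5 : (aeval ![X 0, X 1, 0] : MvPolynomial (Fin 3) k →ₐ[k] A) F = 0 :=
        IsFractionRing.injective A T (by rw [map_zero]; exact h1.symm)
      rw [h4, AlgHom.comp_apply, h5, map_zero] at h2
      simpa using h2
    · have : betaJ k s 0 ∈ RingHom.ker π₁ := by
        rw [h]
        simp [RingHom.mem_ker, hb₂]
      rw [RingHom.mem_ker, hb₁, hy0] at this
      exact hX 1 this
  refine ⟨hM ▸ RingHom.ker_isPrime _, RingHom.ker π₁, RingHom.ker π₂, RingHom.ker_isPrime _,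
    RingHom.ker_isPrime _, bot_lt_iff_ne_bot.mpr fun h => ?_, hPQ, hQM⟩
  have h1 : betaJ k s 1 ∈ RingHom.ker π₁ := by simp [RingHom.mem_ker, hb₁, hy1]
  rw [h, Ideal.mem_bot, ← evalJ_X_one] at h1
  exact X_ne_zero (R := k) (1 : Fin 3) (evalJ_injective 1 (h1.trans (map_zero _).symm))

end Ideals

end David

theorem pow_add_dvd_pow_mul_iff {R : Type*} [CommRing R] [IsDomain R] {a b : R} (ha : a ≠ 0)
    (m n : ℕ) : a ^ (m + n) ∣ a ^ m * b ↔ a ^ n ∣ b := by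
  rw [pow_add, mul_dvd_mul_iff_left (pow_ne_zero m ha)]

namespace David

/-! ### No nonzero element of J is divisible by every power of X -/

section Nested

open Polynomial

variable (k : Type*) [Field k]

/-- The substitution `Y ↦ U + Y ^ m`, `Z ↦ Y` from `k[Y][Z]` to `k[Y][U]`. -/
noncomputable def toLocal (m : ℕ) : k[X][X] →+* k[X][X] :=
  eval₂RingHom (eval₂RingHom ((C : k[X] →+* k[X][X]).comp C) (X + C X ^ m)) (C X)

/-- The substitution `Y ↦ Z`, `U ↦ Y - Z ^ m` from `k[Y][U]` to `k[Y][Z]`. -/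
noncomputable def ofLocal (m : ℕ) : k[X][X] →+* k[X][X] :=
  eval₂RingHom (eval₂RingHom ((C : k[X] →+* k[X][X]).comp C) X) (C X - X ^ m)

theorem ofLocal_toLocal (m : ℕ) (p : k[X][X]) : ofLocal k m (toLocal k m p) = p := by
  have h : (ofLocal k m).comp (toLocal k m) = RingHom.id _ := by
    ext : 2
    · ext
      simp [ofLocal, toLocal]
    · simp [ofLocal, toLocal, eval₂_pow]
    · simp [ofLocal, toLocal]
  exact DFunLike.congr_fun h p

/-- The substitution `U ↦ X Z` from `k[Y][U]` to `k[Y][Z][X]`. -/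
noncomputable def blowup : k[X][X] →+* k[X][X][X] :=
  eval₂RingHom (R := k[X]) (S := k[X][X][X]) (C.comp C) (X * C X)

theorem blowup_X : blowup k X = X * C X := by simp [blowup]

theorem blowup_C (a : k[X]) : blowup k (C a) = C (C a) := by simp [blowup]

theorem coeff_blowup (h : k[X][X]) (i : ℕ) : (blowup k h).coeff i = C (h.coeff i) * X ^ i := by
  induction h using Polynomial.induction_on' with
  | add p q hp hq => simp [hp, hq, add_mul]
  | monomial n a =>
    have hn : blowup k (monomial n a) = C (C a * X ^ n) * X ^ n := by
      rw [blowup, coe_eval₂RingHom, eval₂_monomial]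
      simp only [RingHom.comp_apply, C_mul, C_pow]
      ring
    rw [hn, coeff_C_mul_X_pow, coeff_monomial]
    rcases eq_or_ne n i with rfl | h
    · simp
    · simp [h, h.symm]

/-- The substitution `Y ↦ X Z + Y ^ m`, `Z ↦ Y` of `k[Y][Z][X]`. -/
noncomputable def nestedShift (m : ℕ) : k[X][X][X] →+* k[X][X][X] :=
  eval₂RingHom (R := k[X][X]) (S := k[X][X][X]) ((blowup k).comp (toLocal k m)) X

variable {k}

/-- In the image of the substitution Z occurs only through the product XZ. -/
theorem natDegree_coeff_nestedShift_le (m : ℕ) (f : k[X][X][X]) (i : ℕ) :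
    ((nestedShift k m f).coeff i).natDegree ≤ i := by
  induction f using Polynomial.induction_on' with
  | add p q hp hq =>
    rw [map_add, coeff_add]
    exact (natDegree_add_le _ _).trans (max_le hp hq)
  | monomial n a =>
    rw [nestedShift, coe_eval₂RingHom, eval₂_monomial, coeff_mul_X_pow']
    split_ifs with h
    · rw [RingHom.comp_apply, coeff_blowup]
      exact (natDegree_C_mul_X_pow_le _ _).trans (Nat.sub_le _ _)
    · simp

theorem natDegree_C_X_sub_X_pow {m : ℕ} (hm : m ≠ 0) :
    (C X - X ^ m : k[X][X]).natDegree = m := by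
  rw [natDegree_sub_eq_right_of_natDegree_lt, natDegree_X_pow]
  simpa using Nat.pos_of_ne_zero hm

/-- After the substitution, the order in `X` grows by at most `deg_Z f(0) / m`, and it bounds the
new degree. -/
theorem exists_nestedShift_eq (m : ℕ) (f : k[X][X][X]) (hf : f.coeff 0 ≠ 0) :
    ∃ (r : ℕ) (g : k[X][X][X]), nestedShift k m f = X ^ r * g ∧ g.coeff 0 ≠ 0 ∧
      (g.coeff 0).natDegree ≤ r ∧ r * m ≤ (f.coeff 0).natDegree := by
  set p := f.coeff 0 with hp
  set h := toLocal k m p with hh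
  have hph : ofLocal k m h = p := ofLocal_toLocal k m p
  have h0 : h ≠ 0 := fun h0 => hf (by rw [← hph, h0, map_zero])
  -- Here `h` is f mod X rewritten in U = Y - Z^m and the old Z, and `a` is its order in U. Thus (Y
  -- - Z^m)^a divides `p`, and comparing Z-degrees gives a m ≤ deg_Z p.
  set a := h.natTrailingDegree with ha
  have ham : a * m ≤ p.natDegree := by
    rcases eq_or_ne m 0 with rfl | hm
    · simp
    obtain ⟨h', hh'⟩ : X ^ a ∣ h := X_pow_dvd_iff.mpr fun d hd =>
      coeff_eq_zero_of_lt_natTrailingDegree hd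
    have hX : ofLocal k m X = C X - X ^ m := by simp [ofLocal]
    have hpw : p = (C X - X ^ m) ^ a * ofLocal k m h' := by
      rw [← hph, hh', map_mul, map_pow, hX]
    have hne := hpw ▸ hf
    rw [hpw, natDegree_mul (left_ne_zero_of_mul hne) (right_ne_zero_of_mul hne), natDegree_pow,
      natDegree_C_X_sub_X_pow hm]
    exact Nat.le_add_right _ _
  -- The coefficient of X^a Z^a comes from `h` alone: the terms of f divisible by X contribute
  -- Z-degree at most a - 1 to the coefficient of X^a. So the X-order of the image is at most a.
  have hca : (nestedShift k m f).coeff a ≠ 0 := by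
    intro hzero
    have hdec : nestedShift k m f = nestedShift k m f.divX * X + blowup k h := by
      conv_lhs => rw [← divX_mul_X_add f]
      rw [map_add, map_mul]
      simp [nestedShift, hh, hp]
    have h1 := congrArg (fun q => coeff q a) hzero
    simp only [coeff_zero] at h1
    rw [hdec, coeff_add, coeff_add, coeff_blowup, coeff_C_mul_X_pow, if_pos rfl] at h1
    have h2 : ((nestedShift k m f.divX * X).coeff a).coeff a = 0 := by
      cases a with
      | zero => simp
      | succ b =>
        rw [coeff_mul_X]
        exact coeff_eq_zero_of_natDegree_lt
          ((natDegree_coeff_nestedShift_le m _ b).trans_lt b.lt_succ_self)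
    rw [h2, zero_add] at h1
    exact h0 (trailingCoeff_eq_zero.mp h1)
  set r := (nestedShift k m f).natTrailingDegree with hr
  obtain ⟨g, hg⟩ : X ^ r ∣ nestedShift k m f := X_pow_dvd_iff.mpr fun d hd =>
    coeff_eq_zero_of_lt_natTrailingDegree hd
  have hg0 : g.coeff 0 = (nestedShift k m f).coeff r := by
    rw [hg, coeff_X_pow_mul', if_pos le_rfl, Nat.sub_self]
  refine ⟨r, g, hg, ?_, ?_, ?_⟩
  · rw [hg0]
    exact fun hz => hca (by rw [trailingCoeff_eq_zero.mp hz, coeff_zero])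
  · rw [hg0]
    exact natDegree_coeff_nestedShift_le m f r
  · exact (Nat.mul_le_mul_right m (natTrailingDegree_le_of_ne_zero hca)).trans ham

variable (k) in
/-- The identification of `k[Y][Z][X]` with `k[X, Y, Z]`. -/
noncomputable def toMv : k[X][X][X] →+* MvPolynomial (Fin 3) k :=
  eval₂RingHom (eval₂RingHom (eval₂RingHom MvPolynomial.C (MvPolynomial.X 1)) (MvPolynomial.X 2))
    (MvPolynomial.X 0)

variable (k) in
/-- The identification of `k[X, Y, Z]` with `k[Y][Z][X]`. -/
noncomputable def ofMv : MvPolynomial (Fin 3) k →+* k[X][X][X] :=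
  MvPolynomial.eval₂Hom (S₁ := k[X][X][X]) (C.comp (C.comp C)) ![X, C (C X), C X]

theorem toMv_surjective : Function.Surjective (toMv k) := fun F => by
  have h : (toMv k).comp (ofMv k) = RingHom.id _ := by
    ext i
    · simp [toMv, ofMv]
    · fin_cases i <;> simp [toMv, ofMv]
  exact ⟨ofMv k F, DFunLike.congr_fun h F⟩

theorem toMv_injective : Function.Injective (toMv k) := by
  have h : (ofMv k).comp (toMv k) = RingHom.id _ := by
    ext <;> simp [toMv, ofMv]
  exact Function.LeftInverse.injective (g := ofMv k) fun f => DFunLike.congr_fun h f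

theorem toMv_nestedShift (s : ℕ → ℕ) (n : ℕ) (f : k[X][X][X]) :
    toMv k (nestedShift k (s (n + 2)) f) = shift k s n (toMv k f) := by
  have h : (toMv k).comp (nestedShift k (s (n + 2))) =
      (shift k s n : MvPolynomial (Fin 3) k →+* _).comp (toMv k) := by
    have hC : ∀ a : k, toMv k (C (C (C a))) = MvPolynomial.C a := fun a => by simp [toMv]
    have hY : toMv k (C (C X)) = MvPolynomial.X 1 := by simp [toMv]
    have hZ : toMv k (C X) = MvPolynomial.X 2 := by simp [toMv]
    have hX : toMv k X = MvPolynomial.X 0 := by simp [toMv]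
    ext <;> simp [hC, hY, hZ, hX, nestedShift, toLocal, blowup_X, blowup_C, shift,
      MvPolynomial.algebraMap_eq, mul_comm]
  exact DFunLike.congr_fun h f

variable (k) in
/-- The evaluation `k[Y][Z][X] → J` at `βₙ, βₙ₊₁, X`. -/
noncomputable def nestedEval (s : ℕ → ℕ) (n : ℕ) : k[X][X][X] →+* ring k s :=
  (evalJ k s n : MvPolynomial (Fin 3) k →+* ring k s).comp (toMv k)

variable {s : ℕ → ℕ}

theorem nestedEval_injective (n : ℕ) : Function.Injective (nestedEval k s n) :=
  (evalJ_injective n).comp toMv_injective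

theorem nestedEval_X (n : ℕ) : nestedEval k s n X = xJ k s := by
  simp [nestedEval, toMv, evalJ_X_zero]

theorem nestedEval_nestedShift (n : ℕ) (f : k[X][X][X]) :
    nestedEval k s (n + 1) (nestedShift k (s (n + 2)) f) = nestedEval k s n f := by
  simp [nestedEval, toMv_nestedShift, evalJ_shift]

theorem exists_forall_nestedEval_eq (f : ring k s) :
    ∃ n, ∀ N, n ≤ N → ∃ F, nestedEval k s N F = f := by
  obtain ⟨n, hn⟩ := exists_forall_evalJ_eq f
  refine ⟨n, fun N hN => ?_⟩
  obtain ⟨F, hF⟩ := hn N hN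
  obtain ⟨G, rfl⟩ := toMv_surjective F
  exact ⟨G, hF⟩

theorem exists_nestedEval_succ (n : ℕ) (f : k[X][X][X]) (hf : f.coeff 0 ≠ 0) :
    ∃ (r : ℕ) (g : k[X][X][X]), nestedEval k s n f = xJ k s ^ r * nestedEval k s (n + 1) g ∧
      g.coeff 0 ≠ 0 ∧ (g.coeff 0).natDegree ≤ r ∧ r * s (n + 2) ≤ (f.coeff 0).natDegree := by
  obtain ⟨r, g, hg, h⟩ := exists_nestedShift_eq (s (n + 2)) f hf
  exact ⟨r, g, by rw [← nestedEval_nestedShift, hg, map_mul, map_pow, nestedEval_X], h⟩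

theorem exists_nestedEval_of_le (hs : ∀ n : ℕ, 2 ≤ n → 1 ≤ s n) {n N : ℕ} (hN : n ≤ N)
    (f : k[X][X][X]) (hf : f.coeff 0 ≠ 0) :
    ∃ (r : ℕ) (g : k[X][X][X]), nestedEval k s n f = xJ k s ^ r * nestedEval k s N g ∧
      g.coeff 0 ≠ 0 ∧ (g.coeff 0).natDegree ≤ (f.coeff 0).natDegree ∧
      ((f.coeff 0).natDegree = 0 → r = 0) := by
  induction N, hN using Nat.le_induction with
  | base => exact ⟨0, f, by simp, hf, le_rfl, fun _ => rfl⟩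
  | succ N _ ih =>
    obtain ⟨r, g, hfg, hg, hdeg, hr⟩ := ih
    obtain ⟨r', g', hgg', hg', hdeg', hr'⟩ := exists_nestedEval_succ (s := s) N g hg
    have hle : r' ≤ (g.coeff 0).natDegree :=
      (Nat.le_mul_of_pos_right r' (hs (N + 2) (by omega))).trans hr'
    exact ⟨r + r', g', by rw [hfg, hgg', pow_add, mul_assoc], hg', by omega, fun h0 => by
      have := hr h0
      omega⟩

/-- Descent on the Z-degree of f mod X. A positive degree is at least halved at the next stage with
exponent at least 2, and only a bounded power of X splits off on the way. At degree 0 the reduction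
mod X stays nonzero at all later stages, so X does not divide. -/
theorem exists_not_pow_dvd_nestedEval (hs : ∀ n : ℕ, 2 ≤ n → 1 ≤ s n)
    (hinf : {n : ℕ | 2 ≤ s n}.Infinite) (d n : ℕ) (f : k[X][X][X]) (hf : f.coeff 0 ≠ 0)
    (hd : (f.coeff 0).natDegree = d) : ∃ m, ¬ xJ k s ^ m ∣ nestedEval k s n f := by
  induction d using Nat.strong_induction_on generalizing n f with
  | _ d ih =>
    rcases Nat.eq_zero_or_pos d with rfl | hpos
    · refine ⟨1, ?_⟩
      rw [pow_one]
      rintro ⟨g, hg⟩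
      obtain ⟨N, hN⟩ := exists_forall_nestedEval_eq g
      obtain ⟨G, rfl⟩ := hN (max n N) (le_max_right _ _)
      obtain ⟨r, f', hff', hf', -, hr⟩ := exists_nestedEval_of_le hs (le_max_left n N) f hf
      rw [hr hd, pow_zero, one_mul] at hff'
      rw [hff', ← nestedEval_X, ← map_mul] at hg
      rw [nestedEval_injective _ hg] at hf'
      simp at hf'
    · obtain ⟨N', hN', hlt⟩ := hinf.exists_gt (n + 2)
      obtain ⟨N, rfl⟩ : ∃ N, N' = N + 2 := ⟨N' - 2, by omega⟩
      obtain ⟨r, g, hfg, hg, hdeg, -⟩ := exists_nestedEval_of_le hs (by omega : n ≤ N) f hf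
      obtain ⟨r', g', hgg', hg', hdeg', hr'⟩ := exists_nestedEval_succ (s := s) N g hg
      have h2 : r' * 2 ≤ r' * s (N + 2) := Nat.mul_le_mul_left _ hN'
      obtain ⟨m, hm⟩ := ih _ (by omega) (N + 1) g' hg' rfl
      refine ⟨r + r' + m, fun hdvd => hm ?_⟩
      rwa [hfg, hgg', ← mul_assoc, ← pow_add, pow_add_dvd_pow_mul_iff (xJ_ne_zero (k := k) (s := s))] at hdvd

theorem finiteMultiplicity_xJ (hs : ∀ n : ℕ, 2 ≤ n → 1 ≤ s n)
    (hinf : {n : ℕ | 2 ≤ s n}.Infinite) {f : ring k s} (hf : f ≠ 0) :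
    FiniteMultiplicity (xJ k s) f := by
  obtain ⟨n, hn⟩ := exists_forall_nestedEval_eq f
  obtain ⟨F, rfl⟩ := hn n le_rfl
  have hF : F ≠ 0 := fun h => hf (by rw [h, map_zero])
  obtain ⟨g, hg⟩ : X ^ F.natTrailingDegree ∣ F := X_pow_dvd_iff.mpr fun d hd =>
    coeff_eq_zero_of_lt_natTrailingDegree hd
  have hg0 : g.coeff 0 ≠ 0 := by
    have h1 : g.coeff 0 = F.coeff F.natTrailingDegree := by
      generalize F.natTrailingDegree = j at hg
      simp [hg, coeff_X_pow_mul']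
    rw [h1]
    exact fun hz => hF (trailingCoeff_eq_zero.mp hz)
  obtain ⟨m, hm⟩ := exists_not_pow_dvd_nestedEval hs hinf _ n g hg0 rfl
  refine ⟨F.natTrailingDegree + m, fun hdvd => hm ?_⟩
  have h2 : nestedEval k s n F = xJ k s ^ F.natTrailingDegree * nestedEval k s n g := by
    conv_lhs => rw [hg]
    rw [map_mul, map_pow, nestedEval_X]
  rw [h2] at hdvd
  exact (pow_add_dvd_pow_mul_iff (xJ_ne_zero (k := k) (s := s)) _ _).mp ((pow_dvd_pow _ (Nat.le_succ _)).trans hdvd)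

end Nested

/-! ### Factoriality, and the primes between 0 and M through XJ -/

section Factorial

open MvPolynomial

variable {k : Type*} [Field k] {s : ℕ → ℕ}

theorem xJ_pow_ne_zero (n : ℕ) : xJ k s ^ n ≠ 0 := pow_ne_zero n (xJ_ne_zero (k := k) (s := s))

theorem exists_eq_pow_mul_not_dvd (hs : ∀ n : ℕ, 2 ≤ n → 1 ≤ s n)
    (hinf : {n : ℕ | 2 ≤ s n}.Infinite) {f : ring k s} (hf : f ≠ 0) :
    ∃ n g, f = xJ k s ^ n * g ∧ ¬ xJ k s ∣ g := by
  obtain ⟨g, hg⟩ := (finiteMultiplicity_xJ hs hinf hf).exists_eq_pow_mul_and_not_dvd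
  exact ⟨_, g, hg⟩

/-- Write a nonzero element of a prime P strictly inside XJ as Xⁿg with X ∤ g. Then g ∉ P, so X ∈ P,
a contradiction. -/
theorem bot_covBy_idealX (hs : ∀ n : ℕ, 2 ≤ n → 1 ≤ s n) (hinf : {n : ℕ | 2 ≤ s n}.Infinite) :
    (⟨⊥, Ideal.isPrime_bot⟩ : PrimeSpectrum (ring k s)) ⋖ ⟨idealX k s, idealX_isPrime⟩ := by
  refine ⟨lt_of_le_of_ne (bot_le (α := Ideal (ring k s))) fun h => ?_, fun P hP hPX => ?_⟩
  · have h' : ⊥ = idealX k s := congrArg PrimeSpectrum.asIdeal h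
    have hx : xJ k s ∈ idealX k s := mem_idealX.mpr dvd_rfl
    rw [← h', Ideal.mem_bot] at hx
    exact xJ_ne_zero hx
  · obtain ⟨f, hf, hf0⟩ := SetLike.exists_of_lt (show ⊥ < P.asIdeal from hP)
    obtain ⟨n, g, rfl, hg⟩ := exists_eq_pow_mul_not_dvd hs hinf hf0
    have hle : P.asIdeal ≤ idealX k s := hPX.le
    rcases P.isPrime.mem_or_mem hf with h | h
    · have hx := P.isPrime.mem_of_pow_mem _ h
      exact hPX.not_ge ((Ideal.span_singleton_le_iff_mem _).mpr hx)
    · exact hg (mem_idealX.mp (hle h))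

/-- A prime of the first stage not associated to X stays prime in J[1/X]; dividing out its X-part in
J makes it prime there, as X ∤ q lets powers of X be cancelled from divisibility by q. -/
theorem prime_of_pow_mul_eq_evalJ (p : MvPolynomial (Fin 3) k) (hp : Prime p) {n : ℕ}
    {q : ring k s} (hpq : evalJ k s 0 p = xJ k s ^ n * q) (hpX : ¬ p ∣ X 0)
    (hq : ¬ xJ k s ∣ q) (hu : ¬ IsUnit q) : Prime q := by
  have key : ∀ (a : ring k s) (N : ℕ) (A : MvPolynomial (Fin 3) k),
      xJ k s ^ N * a = evalJ k s 0 A → p ∣ A → q ∣ a := by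
    rintro a N _ hA ⟨D, rfl⟩
    rw [map_mul, hpq] at hA
    have hdvd : xJ k s ^ N ∣ q * (xJ k s ^ n * evalJ k s 0 D) :=
      ⟨a, by rw [hA]; ring⟩
    -- X is prime and does not divide `q`, so the whole power X^N divides the cofactor.
    obtain ⟨c, hc⟩ := prime_xJ.pow_dvd_of_dvd_mul_left N hq hdvd
    refine ⟨c, mul_left_cancel₀ (xJ_pow_ne_zero N) ?_⟩
    rw [hA, mul_left_comm, ← hc]
    ring
  refine ⟨fun h => hq (h ▸ dvd_zero _), hu, fun a b ⟨c, hc⟩ => ?_⟩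
  obtain ⟨Na, A, hA⟩ := exists_pow_mul_eq_evalJ_zero a
  obtain ⟨Nb, B, hB⟩ := exists_pow_mul_eq_evalJ_zero b
  obtain ⟨Nc, C, hC⟩ := exists_pow_mul_eq_evalJ_zero c
  have heq : X 0 ^ (n + Nc) * (A * B) = p * (C * X 0 ^ (Na + Nb)) := by
    apply evalJ_injective (s := s) 0
    simp only [map_mul, map_pow, evalJ_X_zero, ← hA, ← hB, ← hC, hpq]
    linear_combination xJ k s ^ (n + Nc + Na + Nb) * hc
  have hdvd : p ∣ X 0 ^ (n + Nc) * (A * B) := ⟨_, heq⟩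
  rcases hp.dvd_or_dvd hdvd with h | h
  · exact absurd (hp.dvd_of_dvd_pow h) hpX
  · exact (hp.dvd_or_dvd h).imp (key a Na A hA) (key b Nb B hB)

/-- Kaplansky's criterion: every nonzero prime ideal contains a prime element. If X is not in the
ideal, its contraction to k[X, β₀, β₁] is nonzero and contains a prime polynomial, whose X-free part
serves. -/
theorem uniqueFactorizationMonoid_ring (hs : ∀ n : ℕ, 2 ≤ n → 1 ≤ s n)
    (hinf : {n : ℕ | 2 ≤ s n}.Infinite) : UniqueFactorizationMonoid (ring k s) := by
  refine UniqueFactorizationMonoid.iff_exists_prime_mem_of_isPrime.mpr fun P hP hPp => ?_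
  by_cases hx : xJ k s ∈ P
  · exact ⟨_, hx, prime_xJ⟩
  obtain ⟨f, hf, hf0⟩ := Submodule.exists_mem_ne_zero_of_ne_bot hP
  obtain ⟨N, F, hF⟩ := exists_pow_mul_eq_evalJ_zero f
  have hFP : F ∈ P.comap (evalJ k s 0) := by
    rw [Ideal.mem_comap, ← hF]
    exact P.mul_mem_left _ hf
  have hne : P.comap (evalJ k s 0) ≠ ⊥ := by
    intro h
    rw [h, Ideal.mem_bot] at hFP
    rw [hFP, map_zero] at hF
    exact mul_ne_zero (xJ_pow_ne_zero N) hf0 hF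
  obtain ⟨p, hpP, hp⟩ := (Ideal.comap_isPrime (evalJ k s 0) P).exists_mem_prime_of_ne_bot hne
  have hp0 : evalJ k s 0 p ≠ 0 := fun h =>
    hp.ne_zero (evalJ_injective (s := s) 0 (h.trans (map_zero _).symm))
  obtain ⟨n, q, hpq, hq⟩ := exists_eq_pow_mul_not_dvd hs hinf hp0
  have hqP : q ∈ P := by
    have h : xJ k s ^ n * q ∈ P := hpq ▸ hpP
    exact (hPp.mem_or_mem h).resolve_left fun h => hx (hPp.mem_of_pow_mem _ h)
  refine ⟨q, hqP, prime_of_pow_mul_eq_evalJ p hp hpq (fun h => hx ?_) hq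
    fun hu => hPp.ne_top (P.eq_top_of_isUnit_mem hqP hu)⟩
  rw [← evalJ_X_zero 0]
  exact (P.comap (evalJ k s 0)).mem_of_dvd h hpP

/-- Modulo X, βₙ becomes βₙ₊₁^s(n+2), so each stage reduces to polynomials in βₙ₊₁. -/
theorem exists_xJ_dvd_evalJ_sub (n : ℕ) (F : MvPolynomial (Fin 3) k) :
    ∃ h : Polynomial k, xJ k s ∣ evalJ k s n F - Polynomial.aeval (betaJ k s (n + 1)) h := by
  induction F using MvPolynomial.induction_on with
  | C a => exact ⟨Polynomial.C a, by simp [evalJ]⟩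
  | add F G hF hG =>
    obtain ⟨h, hh⟩ := hF
    obtain ⟨h', hh'⟩ := hG
    refine ⟨h + h', ?_⟩
    rw [map_add, map_add, add_sub_add_comm]
    exact dvd_add hh hh'
  | mul_X F i hF =>
    obtain ⟨h, c, hc⟩ := hF
    fin_cases i
    · refine ⟨0, evalJ k s n F, ?_⟩
      rw [map_zero, sub_zero, map_mul, mul_comm]
      exact congrArg (· * _) (evalJ_X_zero n)
    · refine ⟨h * Polynomial.X ^ s (n + 2),
        c * betaJ k s n + Polynomial.aeval (betaJ k s (n + 1)) h * betaJ k s (n + 2), ?_⟩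
      have hX : evalJ k s n (F * X 1) = evalJ k s n F * betaJ k s n := by
        rw [map_mul, evalJ_X_one]
      refine (congrArg (· - _) hX).trans ?_
      simp only [map_mul, map_pow, Polynomial.aeval_X]
      linear_combination betaJ k s n * hc +
        Polynomial.aeval (betaJ k s (n + 1)) h * betaJ_eq (k := k) (s := s) n
    · refine ⟨h * Polynomial.X, c * betaJ k s (n + 1), ?_⟩
      have hX : evalJ k s n (F * X 2) = evalJ k s n F * betaJ k s (n + 1) := by
        rw [map_mul, evalJ_X_two]
      refine (congrArg (· - _) hX).trans ?_
      simp only [map_mul, Polynomial.aeval_X]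
      linear_combination betaJ k s (n + 1) * hc

theorem betaJ_mem_of_mem (hs : ∀ n : ℕ, 2 ≤ n → 1 ≤ s n) {P : Ideal (ring k s)} [P.IsPrime]
    (hx : xJ k s ∈ P) {m : ℕ} (hm : betaJ k s m ∈ P) (n : ℕ) : betaJ k s n ∈ P := by
  have hstep : ∀ i, betaJ k s i ∈ P ↔ betaJ k s (i + 1) ∈ P := fun i => by
    rw [betaJ_eq i, Ideal.add_mem_iff_right P (P.mul_mem_right _ hx)]
    have := hs (i + 2) (by omega)
    exact ⟨fun h => Ideal.IsPrime.mem_of_pow_mem ‹_› _ h, fun h => P.pow_mem_of_mem h _ this⟩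
  have hiff : ∀ i, betaJ k s 0 ∈ P ↔ betaJ k s i ∈ P := fun i => by
    induction i with
    | zero => rfl
    | succ i ih => exact ih.trans (hstep i)
  exact (hiff n).mp ((hiff m).mpr hm)

theorem eq_idealM_of_idealX_lt (hs : ∀ n : ℕ, 2 ≤ n → 1 ≤ s n) (hM : (idealM k s).IsPrime)
    {P : Ideal (ring k s)} [hP : P.IsPrime] (hXP : idealX k s < P) (hPM : P ≤ idealM k s) :
    P = idealM k s := by
  have hx : xJ k s ∈ P := hXP.le (mem_idealX.mpr dvd_rfl)
  obtain ⟨f, hf, hfX⟩ := SetLike.exists_of_lt hXP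
  obtain ⟨n, hn⟩ := exists_forall_evalJ_eq f
  obtain ⟨F, rfl⟩ := hn n le_rfl
  obtain ⟨h, hh⟩ := exists_xJ_dvd_evalJ_sub (s := s) n F
  have hhP : Polynomial.aeval (betaJ k s (n + 1)) h ∈ P := by
    have h1 := P.sub_mem hf (P.mem_of_dvd hh hx)
    rwa [sub_sub_cancel] at h1
  have hh0 : h ≠ 0 := by
    rintro rfl
    rw [map_zero, sub_zero] at hh
    exact hfX (mem_idealX.mpr hh)
  -- With h = T^e g and g(0) ≠ 0, the value g(βₙ₊₁) is a nonzero constant modulo M, so it lies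
  -- outside P and βₙ₊₁ ∈ P. The recursion modulo X then puts every βᵢ in P.
  obtain ⟨g, hg, hgX⟩ := (FiniteMultiplicity.of_not_isUnit Polynomial.not_isUnit_X
    hh0).exists_eq_pow_mul_and_not_dvd
  have hgP : Polynomial.aeval (betaJ k s (n + 1)) g ∉ P := by
    intro hmem
    have hc : algebraMap k (ring k s) (g.coeff 0) ∈ idealM k s := by
      have h1 := hPM hmem
      rw [← Polynomial.divX_mul_X_add g, map_add, map_mul, Polynomial.aeval_X,
        Polynomial.aeval_C] at h1
      have h2 : Polynomial.aeval (betaJ k s (n + 1)) g.divX * betaJ k s (n + 1) ∈ idealM k s :=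
        (idealM k s).mul_mem_left _ (betaJ_mem_idealM (n + 1))
      exact ((idealM k s).add_mem_iff_right h2).mp h1
    refine hM.ne_top (Ideal.eq_top_of_isUnit_mem _ hc (IsUnit.map _ (isUnit_iff_ne_zero.mpr ?_)))
    exact fun h0 => hgX (Polynomial.X_dvd_iff.mpr h0)
  rw [hg, map_mul, map_pow, Polynomial.aeval_X] at hhP
  have hb := hP.mem_of_pow_mem _ ((hP.mem_or_mem hhP).resolve_right hgP)
  exact le_antisymm hPM (idealM_le hx (betaJ_mem_of_mem hs hx hb))

end Factorial

/-! ### Dimension, height of M, and failure of catenarity -/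

section Dimension

variable {k : Type*} [Field k] {s : ℕ → ℕ}

variable (k s) in
theorem exists_ltSeries (hs : ∀ n : ℕ, 2 ≤ n → 1 ≤ s n) (hM : (idealM k s).IsPrime) :
    ∃ c : LTSeries (PrimeSpectrum (ring k s)), c.length = 3 ∧
      c.head = ⟨⊥, Ideal.isPrime_bot⟩ ∧ c.last = ⟨idealM k s, hM⟩ := by
  obtain ⟨-, P, Q, hP, hQ, h0P, hPQ, hQM⟩ := exists_chain k s hs
  let c : LTSeries (PrimeSpectrum (ring k s)) :=
    { length := 3
      toFun := ![⟨⊥, Ideal.isPrime_bot⟩, ⟨P, hP⟩, ⟨Q, hQ⟩, ⟨idealM k s, hM⟩]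
      step := fun i => by
        fin_cases i
        exacts [h0P, hPQ, hQM] }
  exact ⟨c, rfl, rfl, rfl⟩

variable (k s) in
theorem ringKrullDim_ring (hs : ∀ n : ℕ, 2 ≤ n → 1 ≤ s n) : ringKrullDim (ring k s) = 3 := by
  refine le_antisymm ringKrullDim_ring_le ?_
  obtain ⟨c, hc, -⟩ := exists_ltSeries k s hs (exists_chain k s hs).1
  have h := Order.LTSeries.length_le_krullDim c
  rwa [hc] at h

variable (k s) in
theorem isJaffard_ring (hs : ∀ n : ℕ, 2 ≤ n → 1 ≤ s n) : IsJaffard (ring k s) := by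
  have hdim := ringKrullDim_ring k s hs
  refine ⟨by rw [hdim]; exact WithBot.coe_lt_coe.mpr (ENat.natCast_lt_top 3), fun m _ => ?_⟩
  refine le_antisymm ((ringKrullDim_mvPolynomial_ring_le m).trans ?_) ?_
  · rw [hdim, add_comm]
    exact le_rfl
  · have h := ringKrullDim_add_natCard_le_ringKrullDim_mvPolynomial (R := ring k s) (Fin m)
    rwa [Nat.card_eq_fintype_card, Fintype.card_fin, add_comm] at h

variable (k s) in
theorem height_idealM (hs : ∀ n : ℕ, 2 ≤ n → 1 ≤ s n) : (idealM k s).height = 3 := by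
  have hM := (exists_chain k s hs).1
  refine le_antisymm ?_ ?_
  · have h := Ideal.height_le_ringKrullDim_of_ne_top hM.ne_top
    rw [ringKrullDim_ring k s hs] at h
    exact WithBot.coe_le_coe.mp h
  · obtain ⟨c, hc, -, hlast⟩ := exists_ltSeries k s hs hM
    have h := Order.length_le_height (p := c) (x := ⟨idealM k s, hM⟩) hlast.le
    rwa [hc, ← PrimeSpectrum.height_eq_orderHeight] at h

theorem idealX_covBy_idealM (hs : ∀ n : ℕ, 2 ≤ n → 1 ≤ s n)
    (hinf : {n : ℕ | 2 ≤ s n}.Infinite) (hM : (idealM k s).IsPrime) :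
    (⟨idealX k s, idealX_isPrime⟩ : PrimeSpectrum (ring k s)) ⋖ ⟨idealM k s, hM⟩ := by
  refine ⟨lt_of_le_of_ne (show idealX k s ≤ idealM k s from idealX_le_idealM) fun h => ?_,
    fun P hXP hPM => hPM.ne (PrimeSpectrum.ext ?_)⟩
  -- If XJ = M, the chain of length 3 below M would contradict that XJ covers 0.
  · obtain ⟨-, P, Q, hP, -, h0P, hPQ, hQM⟩ := exists_chain k s hs
    refine (bot_covBy_idealX (k := k) hs hinf).2 (c := ⟨P, hP⟩) h0P ?_
    rw [h]
    exact hPQ.trans hQM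
  · exact eq_idealM_of_idealX_lt hs hM hXP hPM.le

theorem not_isCatenarian_ring (hs : ∀ n : ℕ, 2 ≤ n → 1 ≤ s n)
    (hinf : {n : ℕ | 2 ≤ s n}.Infinite) : ¬ IsCatenarian (ring k s) := by
  intro hcat
  have hM := (exists_chain k s hs).1
  obtain ⟨n, hn, hsat⟩ := hcat ⟨⊥, Ideal.isPrime_bot⟩ ⟨idealM k s, hM⟩
    (bot_le (α := Ideal (ring k s)))
  obtain ⟨c, hc, hhead, hlast⟩ := exists_ltSeries k s hs hM
  let d : SaturatedPrimeChain (ring k s) :=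
    { length := 2
      toFun := ![⟨⊥, Ideal.isPrime_bot⟩, ⟨idealX k s, idealX_isPrime⟩, ⟨idealM k s, hM⟩]
      step := fun i => by
        fin_cases i
        exacts [bot_covBy_idealX hs hinf, idealX_covBy_idealM hs hinf hM] }
  -- The saturated chain through XJ forces the common length to be 2, while the chain of length 3
  -- forces it to be at least 3; the latter need not be saturated.
  have h2 : 2 = n := hsat d rfl rfl
  have h3 := hn c hhead hlast
  omega

end Dimension

end David

theorem mainTheorem3 {k : Type*} [Field k] (s : ℕ → ℕ) (hs : ∀ n : ℕ, 2 ≤ n → 1 ≤ s n) :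
    -- `J` is the ascending union of the polynomial rings `J_n` in three indeterminates
    ((∀ n : ℕ, 1 ≤ n →
        AlgebraicIndependent k ![David.x k, David.beta k s (n - 1), David.beta k s n] ∧
        David.stage k s n ≤ David.stage k s (n + 1)) ∧
      (David.ring k s : Set (David.RatField k)) =
        ⋃ n ∈ Set.Ici 1, (David.stage k s n : Set (David.RatField k))) ∧
    -- `J` is a three-dimensional Jaffard domain
    ringKrullDim (David.ring k s) = 3 ∧
    IsJaffard (David.ring k s) ∧
    -- if `s(n) ≥ 2` infinitely often, `J` is factorial, `(0) ⊂ XJ ⊂ M` is a saturated chain of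
    -- primes, `ht M = 3`, and `J` is not catenarian
    ({n : ℕ | 2 ≤ s n}.Infinite →
      UniqueFactorizationMonoid (David.ring k s) ∧
      (∃ (hX : (David.idealX k s).IsPrime) (hM : (David.idealM k s).IsPrime),
        (⟨⊥, Ideal.isPrime_bot⟩ : PrimeSpectrum (David.ring k s)) ⋖ ⟨David.idealX k s, hX⟩ ∧
        (⟨David.idealX k s, hX⟩ : PrimeSpectrum (David.ring k s)) ⋖ ⟨David.idealM k s, hM⟩) ∧
      (David.idealM k s).height = 3 ∧
      ¬ IsCatenarian (David.ring k s)) := by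
  refine ⟨⟨fun n hn => ?_, ?_⟩, David.ringKrullDim_ring k s hs, David.isJaffard_ring k s hs,
    fun hinf => ⟨David.uniqueFactorizationMonoid_ring hs hinf,
      ⟨David.idealX_isPrime, (David.exists_chain k s hs).1, David.bot_covBy_idealX hs hinf,
        David.idealX_covBy_idealM hs hinf _⟩,
      David.height_idealM k s hs, David.not_isCatenarian_ring hs hinf⟩⟩
  · obtain ⟨m, rfl⟩ : ∃ m, n = m + 1 := ⟨n - 1, by omega⟩
    exact ⟨David.stageHom_injective k s m, David.stage_le_succ k s m⟩
  · rw [David.coe_ring]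
    refine Set.Subset.antisymm (Set.iUnion_subset fun n => ?_) (Set.iUnion₂_subset fun n hn => ?_)
    · exact Set.subset_biUnion_of_mem (u := fun n => (David.stage k s n : Set (David.RatField k)))
        (Set.mem_Ici.mpr n.succ_pos)
    · obtain ⟨m, rfl⟩ : ∃ m, n = m + 1 := ⟨n - 1, by have := Set.mem_Ici.mp hn; omega⟩
      exact Set.subset_iUnion (fun n => (David.stage k s (n + 1) : Set (David.RatField k))) m
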